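/- Let $\mathbb{H}=\mathbb{T}\times\mathbb{R}\times\mathbb{R}$ be the (reduced) Heisenberg group, with group law $$(z_1,y_1,x_1)(z_2,y_2,x_2)=\left(z_1z_2e^{-2\pi i x_1y_2},\,y_1+y_2,\,x_1+x_2\right),$$ center $Z$, and Haar measure the product of the normalized Haar measure of $\mathbb{T}$ and Lebesgue measure on $\mathbb{R}^2$. For $h\in\mathbb{H}$ let $L_h$ be the unitary operator $(L_hF)(g)=F(h^{-1}g)$ on $L^2(\mathbb{H})$. Let $F\in L^2(\mathbb{H})$ be nonzero. Suppose that $F$ is (almost everywhere equal to) a function on $\mathbb{H}$ which is Schwartz in the $(y,x)$-variable, that is, $(y,x)\mapsto F(z,y,x)$ is a Schwartz function on $\mathbb{R}^2$ for each $z\in\mathbb{T}$, and which is supported on a half-line in the $x$-variable, that is, for some $c\in\mathbb{R}$ it vanishes whenever $x<c$, or it vanishes whenever $x>c$. Then the Heisenberg-Translate conjecture holds for $F$: for every finite set $\mathcal{F}\subset\mathbb{H}$ such that the cosets $hZ$, $h\in\mathcal{F}$, are distinct, the vectors $L_hF$, $h\in\mathcal{F}$, are linearly independent in $L^2(\mathbb{H})$.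 -/

import Mathlib

open MeasureTheory

noncomputable section

/-- The circle group carries its Borel σ-algebra. -/
instance circleMeasurableSpace : MeasurableSpace Circle := borel Circle

instance circleBorelSpace : BorelSpace Circle := ⟨rfl⟩

/-- The normalized Haar measure (total mass one) on the circle group. -/
def circleHaar : Measure Circle := Measure.haarMeasure ⊤

instance circleHaar_isHaarMeasure : circleHaar.IsHaarMeasure := by
  unfold circleHaar; infer_instance

instance circleHaar_isProbabilityMeasure : IsProbabilityMeasure circleHaar :=
  ⟨by simpa [circleHaar] using Measure.haarMeasure_self (K₀ := (⊤ : TopologicalSpace.PositiveCompacts Circle))⟩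

/-- The (reduced) Heisenberg group, as the set `𝕋 × ℝ × ℝ` of triples `(z, y, x)`; the triple
`(z, y, x)` stands for the unitary operator `z M_y T_x` of `L²(ℝ)`. -/
def Heisenberg : Type := Circle × ℝ × ℝ

namespace Heisenberg

/-- The element `(z, y, x)`. -/
def mk (z : Circle) (y x : ℝ) : Heisenberg := (z, y, x)

/-- The circle coordinate of `(z, y, x)`. -/
def z (h : Heisenberg) : Circle := h.1

/-- The modulation coordinate of `(z, y, x)`. -/
def y (h : Heisenberg) : ℝ := h.2.1

/-- The translation coordinate of `(z, y, x)`. -/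
def x (h : Heisenberg) : ℝ := h.2.2

@[ext] theorem ext {g h : Heisenberg} (hz : g.z = h.z) (hy : g.y = h.y) (hx : g.x = h.x) :
    g = h := Prod.ext hz (Prod.ext hy hx)

/-- `(z₁, y₁, x₁) (z₂, y₂, x₂) = (z₁ z₂ e^{-2πi x₁ y₂}, y₁ + y₂, x₁ + x₂)`. -/
instance : Mul Heisenberg :=
  ⟨fun g h => mk (g.z * h.z * Circle.exp (-(2 * Real.pi * (g.x * h.y)))) (g.y + h.y) (g.x + h.x)⟩

instance : One Heisenberg := ⟨mk 1 0 0⟩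

instance : Inv Heisenberg :=
  ⟨fun g => mk (g.z⁻¹ * Circle.exp (-(2 * Real.pi * (g.x * g.y)))) (-g.y) (-g.x)⟩

@[simp] theorem mk_z (a : Circle) (b c : ℝ) : (mk a b c).z = a := rfl
@[simp] theorem mk_y (a : Circle) (b c : ℝ) : (mk a b c).y = b := rfl
@[simp] theorem mk_x (a : Circle) (b c : ℝ) : (mk a b c).x = c := rfl
@[simp] theorem mul_z (g h : Heisenberg) :
    (g * h).z = g.z * h.z * Circle.exp (-(2 * Real.pi * (g.x * h.y))) := rfl
@[simp] theorem mul_y (g h : Heisenberg) : (g * h).y = g.y + h.y := rfl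
@[simp] theorem mul_x (g h : Heisenberg) : (g * h).x = g.x + h.x := rfl
@[simp] theorem one_z : (1 : Heisenberg).z = 1 := rfl
@[simp] theorem one_y : (1 : Heisenberg).y = 0 := rfl
@[simp] theorem one_x : (1 : Heisenberg).x = 0 := rfl
@[simp] theorem inv_z (g : Heisenberg) :
    (g⁻¹).z = g.z⁻¹ * Circle.exp (-(2 * Real.pi * (g.x * g.y))) := rfl
@[simp] theorem inv_y (g : Heisenberg) : (g⁻¹).y = -g.y := rfl
@[simp] theorem inv_x (g : Heisenberg) : (g⁻¹).x = -g.x := rfl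

instance : Group Heisenberg where
  mul_assoc a b c := by
    ext1
    · have key : Circle.exp (-(2 * Real.pi * (a.x * b.y))) *
          Circle.exp (-(2 * Real.pi * ((a.x + b.x) * c.y))) =
          Circle.exp (-(2 * Real.pi * (b.x * c.y))) *
          Circle.exp (-(2 * Real.pi * (a.x * (b.y + c.y)))) := by
        rw [← Circle.exp_add, ← Circle.exp_add]; congr 1; ring
      simp only [mul_z, mul_x, mul_y]
      calc _ = a.z * b.z * c.z * (Circle.exp (-(2 * Real.pi * (a.x * b.y))) *
            Circle.exp (-(2 * Real.pi * ((a.x + b.x) * c.y)))) := by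
              simp only [mul_assoc, mul_left_comm, mul_comm]
        _ = _ := by rw [key]; simp only [mul_assoc]
    · simp [add_assoc]
    · simp [add_assoc]
  one_mul a := by ext1 <;> simp
  mul_one a := by ext1 <;> simp
  inv_mul_cancel a := by
    ext1
    · have key : Circle.exp (-(2 * Real.pi * (a.x * a.y))) *
          Circle.exp (-(2 * Real.pi * (-a.x * a.y))) = 1 := by
        rw [← Circle.exp_add]; ring_nf; simp
      simp only [mul_z, inv_z, inv_x, one_z]
      calc _ = a.z⁻¹ * a.z * (Circle.exp (-(2 * Real.pi * (a.x * a.y))) *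
            Circle.exp (-(2 * Real.pi * (-a.x * a.y)))) := by
              simp only [mul_assoc, mul_left_comm, mul_comm]
        _ = 1 := by rw [key]; simp
    · simp
    · simp

instance : MeasurableSpace Heisenberg := inferInstanceAs (MeasurableSpace (Circle × ℝ × ℝ))

/-- The Haar measure of the Heisenberg group: the product of the normalized Haar measure of `𝕋`
and of the Lebesgue measures of the two real coordinates. -/
def haar : Measure Heisenberg :=
  (circleHaar.prod ((volume : Measure ℝ).prod (volume : Measure ℝ)) : Measure (Circle × ℝ × ℝ))

/-- Left translations preserve the Haar measure. -/
theorem measurePreserving_mul_left (k : Heisenberg) :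
    MeasurePreserving (fun h : Heisenberg => k * h) haar haar := by
  have h1 : MeasurePreserving
      (fun q : ℝ × ℝ => (k.y + q.1, k.x + q.2)) (volume.prod volume) (volume.prod volume) :=
    (measurePreserving_add_left volume k.y).prod (measurePreserving_add_left volume k.x)
  have h2 : MeasurePreserving
      (fun p : (ℝ × ℝ) × Circle =>
        ((k.y + p.1.1, k.x + p.1.2),
          k.z * p.2 * Circle.exp (-(2 * Real.pi * (k.x * p.1.1)))))
      ((volume.prod volume).prod circleHaar) ((volume.prod volume).prod circleHaar) := by
    refine MeasurePreserving.skew_product h1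
      (g := fun (q : ℝ × ℝ) (w : Circle) =>
        k.z * w * Circle.exp (-(2 * Real.pi * (k.x * q.1)))) ?_ ?_
    · have : Continuous (Function.uncurry fun (q : ℝ × ℝ) (w : Circle) =>
          k.z * w * Circle.exp (-(2 * Real.pi * (k.x * q.1)))) := by
        unfold Function.uncurry; fun_prop
      exact this.measurable
    · refine Filter.Eventually.of_forall fun q => ?_
      exact ((measurePreserving_mul_right circleHaar
        (Circle.exp (-(2 * Real.pi * (k.x * q.1))))).comp
        (_root_.MeasureTheory.measurePreserving_mul_left circleHaar k.z)).map_eq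
  have h3 := (Measure.measurePreserving_swap (μ := (volume : Measure ℝ).prod volume)
    (ν := circleHaar)).comp (h2.comp (Measure.measurePreserving_swap (μ := circleHaar)
      (ν := (volume : Measure ℝ).prod volume)))
  exact h3

/-- The Hilbert space `L²(ℍ)`. -/
abbrev L2 : Type := Lp ℂ 2 haar

/-- The unitary left translation operator `(L_k F)(h) = F(k⁻¹ h)` of `L²(ℍ)`. -/
def leftTranslate (k : Heisenberg) : L2 →ₗᵢ[ℂ] L2 :=
  Lp.compMeasurePreservingₗᵢ ℂ (fun h : Heisenberg => k⁻¹ * h) (measurePreserving_mul_left k⁻¹)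

/-- The Heisenberg-Translate conjecture holds for `F`: for every finite set `S ⊆ ℍ` whose elements
lie in pairwise distinct cosets of the center `Z` of `ℍ`, the family of vectors `L_h F`, `h ∈ S`,
is linearly independent over `ℂ` in `L²(ℍ)`. -/
def HTConjectureFor (F : L2) : Prop :=
  ∀ S : Finset Heisenberg,
    Set.InjOn (fun h : Heisenberg => (h : Heisenberg ⧸ Subgroup.center Heisenberg)) (S : Set Heisenberg) →
      LinearIndependent ℂ (fun h : S => leftTranslate (h : Heisenberg) F)

/-- `f` is Schwartz in the `(y, x)`-variable: for each `z ∈ 𝕋`, the function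
`(y, x) ↦ f (z, y, x)` is a Schwartz function on `ℝ²`. -/
def IsSchwartzInYX (f : Heisenberg → ℂ) : Prop :=
  ∀ a : Circle, ∃ g : SchwartzMap (ℝ × ℝ) ℂ, ∀ b c : ℝ, f (mk a b c) = g (b, c)

/-- `f` is supported on a half-line in the `x`-variable: it vanishes off `{x ≥ c}` or off
`{x ≤ c}`, for some real `c`. -/
def IsSupportedOnHalfLineInX (f : Heisenberg → ℂ) : Prop :=
  ∃ c : ℝ, (∀ h : Heisenberg, f h ≠ 0 → c ≤ h.x) ∨ (∀ h : Heisenberg, f h ≠ 0 → h.x ≤ c)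

end Heisenberg

end

/-! A linear relation between left translates of `f` forces any half-space of vanishing to grow.
Suppose all coefficients are nonzero and `f` vanishes for `σ x < t`, with `σ = ±1` in the
application. Near the edge of that half-space only the translates by those `h j` with least `σ x`
contribute: the others still see the zero region on a strip whose width `δ` is the gap to the next
value of `σ x`. After a translation in `x`, the surviving terms only move `(z, y)`, and the group
twist disappears.

On the strip this is a convolution relation on `𝕋 × ℝ`, with `x` as a parameter. A Fourier transform
in `y` and Fourier series in `z` turn it into multiplication by trigonometric polynomials in `ξ`,
one for each `n`. Their frequencies are the `y`-coordinates, distinct because the cosets are, so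
they vanish almost nowhere and `f` is zero on the strip (`ae_eq_zero_of_sum_mul_translate_eq_zero`).
Since `δ` does not depend on `t`, iteration gives `f = 0` (`exists_pos_vanishing_extends`). -/

open scoped FourierTransform SchwartzMap

/-! ### Fourier series on the circle -/

/-- The character `w ↦ w ^ n` of the circle, as a continuous complex-valued function. -/
noncomputable def circleCharacter (n : ℤ) : C(Circle, ℂ) where
  toFun w := ((w ^ n : Circle) : ℂ)
  continuous_toFun := continuous_subtype_val.comp (continuous_zpow n)

@[simp] theorem circleCharacter_apply (n : ℤ) (w : Circle) :
    circleCharacter n w = ((w ^ n : Circle) : ℂ) := rfl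

/-- The star subalgebra of `C(Circle, ℂ)` generated by the characters. -/
noncomputable def circleCharacterSubalgebra : StarSubalgebra ℂ C(Circle, ℂ) where
  toSubalgebra := Algebra.adjoin ℂ (Set.range circleCharacter)
  star_mem' := by
    change Algebra.adjoin ℂ (Set.range circleCharacter) ≤
      star (Algebra.adjoin ℂ (Set.range circleCharacter))
    refine Algebra.adjoin_le ?_
    rintro - ⟨n, rfl⟩
    refine Algebra.subset_adjoin ⟨-n, ContinuousMap.ext fun w => ?_⟩
    simp only [circleCharacter_apply, zpow_neg, Circle.coe_inv_eq_conj]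
    rfl

theorem circleCharacterSubalgebra_coe :
    Subalgebra.toSubmodule circleCharacterSubalgebra.toSubalgebra =
      Submodule.span ℂ (Set.range circleCharacter) := by
  apply Algebra.adjoin_eq_span_of_subset
  refine Set.Subset.trans ?_ Submodule.subset_span
  intro f hf
  refine Submonoid.closure_induction (fun _ => id) ⟨0, ?_⟩ ?_ hf
  · ext1 w; simp
  · rintro - - - - ⟨m, rfl⟩ ⟨n, rfl⟩
    exact ⟨m + n, ContinuousMap.ext fun w => by simp [zpow_add]⟩

theorem circleCharacterSubalgebra_separatesPoints :
    circleCharacterSubalgebra.SeparatesPoints := by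
  intro v w hvw
  refine ⟨_, ⟨circleCharacter 1, Algebra.subset_adjoin ⟨1, rfl⟩, rfl⟩, ?_⟩
  simpa [Circle.coe_inj] using hvw

theorem span_circleCharacter_closure_eq_top :
    (Submodule.span ℂ (Set.range circleCharacter)).topologicalClosure = ⊤ := by
  rw [← circleCharacterSubalgebra_coe]
  exact congr_arg (Subalgebra.toSubmodule <| StarSubalgebra.toSubalgebra ·)
    (ContinuousMap.starSubalgebra_topologicalClosure_eq_top_of_separatesPoints
      circleCharacterSubalgebra circleCharacterSubalgebra_separatesPoints)

/-- Uniform density passes to `L²` because continuous functions are dense there and `toLp` is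
continuous. -/
theorem span_toLp_circleCharacter_closure_eq_top :
    (Submodule.span ℂ (Set.range fun n => ContinuousMap.toLp (E := ℂ) 2 circleHaar ℂ
      (circleCharacter n))).topologicalClosure = ⊤ := by
  have h := (ContinuousMap.toLp_denseRange ℂ circleHaar ℂ
    (ENNReal.ofNat_ne_top (n := 2))).topologicalClosure_map_submodule
      span_circleCharacter_closure_eq_top
  rw [Submodule.map_span, ← Set.range_comp] at h
  exact h

/-- A square-integrable function on the circle whose Fourier coefficients all vanish is zero. -/
theorem ae_eq_zero_of_integral_circleCharacter_mul_eq_zero {u : Circle → ℂ}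
    (hu : MemLp u 2 circleHaar)
    (h : ∀ n : ℤ, ∫ w, circleCharacter n w * u w ∂circleHaar = 0) :
    u =ᵐ[circleHaar] 0 := by
  have h0 : hu.toLp u = 0 := by
    refine (Submodule.dense_iff_topologicalClosure_eq_top.mpr
      span_toLp_circleCharacter_closure_eq_top).eq_zero_of_mem_orthogonal (𝕜 := ℂ) ?_
    rw [Submodule.mem_orthogonal]
    intro v hv
    induction hv using Submodule.span_induction with
    | mem v hv =>
      obtain ⟨n, rfl⟩ := hv
      rw [L2.inner_def, ← h (-n)]
      refine integral_congr_ae ?_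
      filter_upwards [ContinuousMap.coeFn_toLp (𝕜 := ℂ) (p := 2) circleHaar (circleCharacter n),
        hu.coeFn_toLp] with w h1 h2
      rw [h1, h2]
      simp only [circleCharacter_apply, zpow_neg, Circle.coe_inv_eq_conj, RCLike.inner_apply']
    | zero => simp
    | add v w _ _ hv hw => rw [inner_add_left, hv, hw, add_zero]
    | smul a v _ hv => rw [inner_smul_left, hv, mul_zero]
  exact (hu.toLp_eq_toLp_iff MemLp.zero).mp (h0.trans (MemLp.toLp_zero _).symm)

theorem integral_circleCharacter_mul_comp_mul (n : ℤ) (a : Circle) (u : Circle → ℂ) :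
    ∫ w, circleCharacter n w * u (a * w) ∂circleHaar =
      ((a ^ (-n) : Circle) : ℂ) * ∫ w, circleCharacter n w * u w ∂circleHaar := by
  rw [← integral_const_mul,
    ← integral_mul_left_eq_self (μ := circleHaar)
      (fun w => ((a ^ (-n) : Circle) : ℂ) * (circleCharacter n w * u w)) a]
  refine integral_congr_ae (Filter.Eventually.of_forall fun w => ?_)
  simp only [circleCharacter_apply, mul_zpow, zpow_neg, Circle.coe_mul, Circle.coe_inv]
  have : ((a ^ n : Circle) : ℂ) ≠ 0 := Circle.coe_ne_zero _
  field_simp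

/-- A square-integrable function on the circle is zero if it is annihilated by a linear
combination of rotations whose symbol has no zero. -/
theorem ae_eq_zero_of_sum_mul_comp_mul_eq_zero {ι : Type*} (s : Finset ι) (b : ι → ℂ)
    (a : ι → Circle) {u : Circle → ℂ} (hu : MemLp u 2 circleHaar)
    (hsymbol : ∀ n : ℤ, ∑ j ∈ s, b j * ((a j ^ n : Circle) : ℂ) ≠ 0)
    (h : ∀ᵐ w ∂circleHaar, ∑ j ∈ s, b j * u (a j * w) = 0) :
    u =ᵐ[circleHaar] 0 := by
  refine ae_eq_zero_of_integral_circleCharacter_mul_eq_zero hu fun n => ?_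
  have hint : ∀ j ∈ s, Integrable
      (fun w => b j * (circleCharacter n w * u (a j * w))) circleHaar := by
    intro j _
    have hu1 : Integrable (fun w => u (a j * w)) circleHaar :=
      (hu.integrable one_le_two).comp_mul_left (a j)
    refine (hu1.bdd_mul (c := 1) (circleCharacter n).continuous.aestronglyMeasurable ?_).const_mul _
    exact Filter.Eventually.of_forall fun w => (Circle.norm_coe _).le
  have h1 : ∑ j ∈ s, b j * (((a j ^ (-n) : Circle) : ℂ) *
      ∫ w, circleCharacter n w * u w ∂circleHaar) = 0 := by
    simp_rw [← integral_circleCharacter_mul_comp_mul, ← integral_const_mul]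
    rw [← integral_finsetSum s hint]
    refine integral_eq_zero_of_ae ?_
    filter_upwards [h] with w hw
    have : ∑ j ∈ s, b j * (circleCharacter n w * u (a j * w)) =
        circleCharacter n w * ∑ j ∈ s, b j * u (a j * w) := by
      rw [Finset.mul_sum]; exact Finset.sum_congr rfl fun _ _ => by ring
    simp only [this, hw, mul_zero, Pi.zero_apply]
  simp_rw [← mul_assoc] at h1
  rw [← Finset.sum_mul] at h1
  exact (mul_eq_zero.mp h1).resolve_left (hsymbol (-n))

/-! ### Zeros of trigonometric polynomials on the line -/

/-- The character `t ↦ e^{-2πipt}` of the real line. -/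
noncomputable def realCharacter (p : ℝ) : Multiplicative ℝ →* ℂ where
  toFun t := (𝐞 (-(p * t.toAdd)) : ℂ)
  map_one' := by simp
  map_mul' s t := by
    rw [toAdd_mul, mul_add, neg_add, AddChar.map_add_eq_mul, Circle.coe_mul]

theorem realCharacter_injective : Function.Injective realCharacter := by
  intro p q h
  by_contra hpq
  have hpq' : p - q ≠ 0 := sub_ne_zero.mpr hpq
  -- At `t = 1 / (2 (p - q))` the quotient of the two characters is `e^{-πi} = -1`.
  have h1 : (𝐞 (-(p * (1 / (2 * (p - q))))) : ℂ) = 𝐞 (-(q * (1 / (2 * (p - q))))) :=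
    DFunLike.congr_fun h (Multiplicative.ofAdd (1 / (2 * (p - q))))
  rw [Circle.coe_inj] at h1
  have h2 : 𝐞 (-(p * (1 / (2 * (p - q)))) - -(q * (1 / (2 * (p - q))))) = 1 := by
    rw [AddChar.map_sub_eq_div, h1, div_self']
  have h3 : -(p * (1 / (2 * (p - q)))) - -(q * (1 / (2 * (p - q)))) = -(1 / 2) := by
    field_simp; ring
  rw [h3] at h2
  have h4 := congrArg (fun w : Circle => (w : ℂ)) h2
  simp only [Real.fourierChar_apply, Circle.coe_one] at h4
  have h5 : ((2 * Real.pi * -(1 / 2) : ℝ) : ℂ) * Complex.I = -(Real.pi * Complex.I) := by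
    push_cast; ring
  rw [h5, Complex.exp_neg, Complex.exp_pi_mul_I] at h4
  norm_num at h4

/-- A nontrivial trigonometric polynomial on the line vanishes almost nowhere. -/
theorem ae_sum_mul_fourierChar_ne_zero {ι : Type*} {s : Finset ι} (hs : s.Nonempty)
    {b : ι → ℂ} (hb : ∀ j ∈ s, b j ≠ 0) {p : ι → ℝ} (hp : Set.InjOn p s) :
    ∀ᵐ ξ : ℝ, ∑ j ∈ s, b j * (𝐞 (-(p j * ξ)) : ℂ) ≠ 0 := by
  set P : ℝ → ℂ := fun ξ => ∑ j ∈ s, b j * (𝐞 (-(p j * ξ)) : ℂ) with hP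
  have hanalytic : AnalyticOnNhd ℝ P Set.univ := by
    have : ContDiff ℝ ⊤ P := by
      simp only [hP, Real.fourierChar_apply]
      refine ContDiff.sum fun j _ =>
        contDiff_const.mul (ContDiff.cexp (ContDiff.mul ?_ contDiff_const))
      have hj : ContDiff ℝ ⊤ fun ξ : ℝ => 2 * Real.pi * -(p j * ξ) := by fun_prop
      exact Complex.ofRealCLM.contDiff.comp hj
    exact fun ξ _ => this.contDiffAt.analyticAt
  have hne : P ≠ 0 := by
    intro h0
    -- Dedekind: distinct characters are linearly independent, so `P = 0` would kill every
    -- coefficient.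
    have hli : LinearIndependent ℂ
        (fun j : s => (realCharacter (p j) : Multiplicative ℝ → ℂ)) :=
      (linearIndependent_monoidHom (Multiplicative ℝ) ℂ).comp
        (fun j : s => realCharacter (p j))
        (fun i j hij => Subtype.ext (hp i.2 j.2 (realCharacter_injective hij)))
    obtain ⟨j, hj⟩ := hs
    refine hb j hj (Fintype.linearIndependent_iff.mp hli (fun j => b j) ?_ ⟨j, hj⟩)
    funext t
    have := congrFun h0 t.toAdd
    simp only [hP, ← Finset.sum_coe_sort s] at this
    simpa [Finset.sum_apply, realCharacter] using this
  -- The zeros of a nonzero analytic function are isolated, hence form a null set.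
  have hcod : {ξ | P ξ ≠ 0} ∈ Filter.codiscrete ℝ := by
    rw [mem_codiscrete]
    intro ξ
    rw [Filter.disjoint_principal_right, compl_compl]
    by_contra hfreq
    refine hne (funext fun η => ?_)
    refine hanalytic.eqOn_zero_of_preconnected_of_frequently_eq_zero isPreconnected_univ
      (Set.mem_univ ξ) ?_ (Set.mem_univ η)
    rw [Filter.Frequently]
    exact hfreq
  have hle := ae_restrict_le_codiscreteWithin (μ := (volume : Measure ℝ)) MeasurableSet.univ
  rw [Measure.restrict_univ] at hle
  exact hle hcod

/-! ### Null functions and square-integrability on slices -/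

section Slices

variable {α β : Type*} [MeasurableSpace α] [MeasurableSpace β] {μ : Measure α} {ν : Measure β}
  [SFinite μ] [SFinite ν]

theorem ae_prod_eq_zero_of_ae_ae_eq_zero {f : α × β → ℂ}
    (hf : AEStronglyMeasurable f (μ.prod ν)) (h : ∀ᵐ b ∂ν, ∀ᵐ a ∂μ, f (a, b) = 0) :
    f =ᵐ[μ.prod ν] 0 := by
  have h0 : ∫⁻ q, ‖f q‖ₑ ∂(μ.prod ν) = 0 := by
    rw [lintegral_prod_symm _ hf.enorm]
    refine (lintegral_congr_ae ?_).trans lintegral_zero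
    filter_upwards [h] with b hb
    refine (lintegral_congr_ae ?_).trans lintegral_zero
    filter_upwards [hb] with a ha
    simp [ha]
  rw [lintegral_eq_zero_iff' hf.enorm] at h0
  filter_upwards [h0] with q hq
  simpa using hq

theorem MeasureTheory.MemLp.ae_memLp_two_slice {f : α × β → ℂ} (hf : MemLp f 2 (μ.prod ν)) :
    ∀ᵐ b ∂ν, MemLp (fun a => f (a, b)) 2 μ := by
  have h1 := ((memLp_two_iff_integrable_sq_norm hf.1).mp hf).prod_left_ae
  have h2 := hf.1.prod_swap.prodMk_left
  filter_upwards [h1, h2] with b hb1 hb2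
  exact (memLp_two_iff_integrable_sq_norm hb2).mpr hb1

end Slices

/-! ### Plancherel in one variable with parameters -/

section PartialFourier

variable {α : Type*}

/-- The Fourier transform in the second variable. -/
noncomputable def partialFourier (G : α × ℝ → ℂ) (q : α × ℝ) : ℂ :=
  𝓕 (fun y => G (q.1, y)) q.2

/-- The slices `y ↦ G (a, y)` are Schwartz functions. -/
def HasSchwartzSlices (G : α × ℝ → ℂ) : Prop :=
  ∀ a, ∃ g : 𝓢(ℝ, ℂ), ∀ y, G (a, y) = g y

theorem partialFourier_apply (G : α × ℝ → ℂ) (q : α × ℝ) :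
    partialFourier G q = ∫ y, 𝐞 (-(y * q.2)) • G (q.1, y) :=
  Real.fourier_real_eq _ _

theorem integral_norm_sq_partialFourier {G : α × ℝ → ℂ} (hG : HasSchwartzSlices G) (a : α) :
    ∫ ξ, ‖partialFourier G (a, ξ)‖ ^ 2 = ∫ y, ‖G (a, y)‖ ^ 2 := by
  obtain ⟨g, hg⟩ := hG a
  simp only [partialFourier, hg]
  exact SchwartzMap.integral_norm_sq_fourier g

theorem integrable_norm_sq_partialFourier {G : α × ℝ → ℂ} (hG : HasSchwartzSlices G) (a : α) :
    Integrable fun ξ => ‖partialFourier G (a, ξ)‖ ^ 2 := by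
  obtain ⟨g, hg⟩ := hG a
  simp only [partialFourier, hg]
  have h := (𝓕 g).memLp 2 (volume : Measure ℝ)
  exact (memLp_two_iff_integrable_sq_norm h.1).mp h

theorem partialFourier_comp_sub (G : α × ℝ → ℂ) (a : α) (p ξ : ℝ) :
    ∫ y, 𝐞 (-(y * ξ)) • G (a, y - p) = (𝐞 (-(p * ξ)) : ℂ) * partialFourier G (a, ξ) := by
  rw [partialFourier_apply, ← integral_const_mul,
    ← integral_sub_right_eq_self
      (fun y => (𝐞 (-(p * ξ)) : ℂ) * (𝐞 (-(y * ξ)) • G (a, y))) p]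
  refine integral_congr_ae (Filter.Eventually.of_forall fun y => ?_)
  simp only [Circle.smul_def, smul_eq_mul]
  rw [← mul_assoc, ← Circle.coe_mul, ← AddChar.map_add_eq_mul]
  congr 4
  ring

theorem HasSchwartzSlices.integrable_comp_sub {G : α × ℝ → ℂ} (hG : HasSchwartzSlices G) (a : α)
    (p ξ : ℝ) : Integrable fun y => 𝐞 (-(y * ξ)) • G (a, y - p) := by
  obtain ⟨g, hg⟩ := hG a
  simp only [hg, Circle.smul_def, smul_eq_mul]
  refine (g.integrable.comp_sub_right p).bdd_mul (c := 1) ?_ ?_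
  · exact Continuous.aestronglyMeasurable (by fun_prop)
  · exact Filter.Eventually.of_forall fun y => (Circle.norm_coe _).le

variable [MeasurableSpace α] {μ : Measure α} [SFinite μ]

theorem aestronglyMeasurable_partialFourier {G : α × ℝ → ℂ}
    (hG : AEStronglyMeasurable G (μ.prod volume)) :
    AEStronglyMeasurable (partialFourier G) (μ.prod volume) := by
  have h1 : AEStronglyMeasurable (fun r : (α × ℝ) × ℝ => G (r.1.1, r.2))
      ((μ.prod volume).prod volume) :=
    hG.comp_quasiMeasurePreserving
      (QuasiMeasurePreserving.prodMap Measure.quasiMeasurePreserving_fst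
        (Measure.QuasiMeasurePreserving.id _))
  have h2 : AEStronglyMeasurable (fun r : (α × ℝ) × ℝ => 𝐞 (-(r.2 * r.1.2)) • G (r.1.1, r.2))
      ((μ.prod volume).prod volume) := by
    simp only [Circle.smul_def, smul_eq_mul]
    refine AEStronglyMeasurable.mul ?_ h1
    have hc : Continuous fun t : ℝ × ℝ => (𝐞 (-(t.2 * t.1)) : ℂ) := by fun_prop
    exact (hc.measurable.comp ((measurable_snd.comp measurable_fst).prodMk
      measurable_snd)).aestronglyMeasurable
  exact h2.integral_prod_right'.congr
    (Filter.Eventually.of_forall fun q => (partialFourier_apply G q).symm)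

/-- Plancherel holds on every slice, since the slices are Schwartz; integrating over the parameter
gives it on the product. -/
theorem memLp_two_partialFourier {G : α × ℝ → ℂ} (hG : MemLp G 2 (μ.prod volume))
    (hS : HasSchwartzSlices G) : MemLp (partialFourier G) 2 (μ.prod volume) := by
  have hm := aestronglyMeasurable_partialFourier hG.1
  rw [memLp_two_iff_integrable_sq_norm hm, integrable_prod_iff (by fun_prop)]
  refine ⟨Filter.Eventually.of_forall (integrable_norm_sq_partialFourier hS), ?_⟩
  simp only [norm_pow, norm_norm, integral_norm_sq_partialFourier hS]
  exact ((memLp_two_iff_integrable_sq_norm hG.1).mp hG).integral_prod_left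

theorem ae_eq_zero_of_partialFourier_ae_eq_zero {G : α × ℝ → ℂ}
    (hG : MemLp G 2 (μ.prod volume)) (hS : HasSchwartzSlices G)
    (h : partialFourier G =ᵐ[μ.prod volume] 0) : G =ᵐ[μ.prod volume] 0 := by
  have hint := (memLp_two_iff_integrable_sq_norm hG.1).mp hG
  have hint' := (memLp_two_iff_integrable_sq_norm
    (memLp_two_partialFourier hG hS).1).mp (memLp_two_partialFourier hG hS)
  have h0 : ∫ q, ‖G q‖ ^ 2 ∂(μ.prod volume) = 0 := by
    rw [integral_prod _ hint]
    simp only [← integral_norm_sq_partialFourier hS]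
    rw [← integral_prod _ hint']
    refine integral_eq_zero_of_ae ?_
    filter_upwards [h] with q hq
    simp [hq]
  rw [integral_eq_zero_iff_of_nonneg (fun _ => by positivity) hint] at h0
  filter_upwards [h0] with q hq
  simpa using hq

end PartialFourier

/-! ### Translation relations on `𝕋 × ℝ` -/

/-- Translates of a nonzero square-integrable function on `𝕋 × ℝ` by elements with distinct real
coordinates are linearly independent, in a measurable family parametrized by `x`. -/
theorem ae_eq_zero_of_sum_mul_translate_eq_zero {ι : Type*} {s : Finset ι} (hs : s.Nonempty)
    {c : ι → ℂ} (hc : ∀ j ∈ s, c j ≠ 0) (a : ι → Circle) {p : ι → ℝ} (hp : Set.InjOn p s)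
    {G : (Circle × ℝ) × ℝ → ℂ} (hG : MemLp G 2 ((circleHaar.prod volume).prod volume))
    (hS : HasSchwartzSlices G)
    (h : ∀ᵐ q ∂((circleHaar.prod volume).prod volume),
      ∑ j ∈ s, c j * G ((a j * q.1.1, q.1.2), q.2 - p j) = 0) :
    G =ᵐ[(circleHaar.prod volume).prod volume] 0 := by
  refine ae_eq_zero_of_partialFourier_ae_eq_zero hG hS ?_
  have hφ := memLp_two_partialFourier hG hS
  have hassoc : MeasurePreserving (MeasurableEquiv.prodAssoc.symm : Circle × ℝ × ℝ ≃ᵐ _)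
      (circleHaar.prod (volume.prod volume)) ((circleHaar.prod volume).prod volume) :=
    (measurePreserving_prodAssoc circleHaar volume volume).symm _
  have hφ' : MemLp (fun r : Circle × ℝ × ℝ => partialFourier G ((r.1, r.2.1), r.2.2)) 2
      (circleHaar.prod (volume.prod volume)) := hφ.comp_measurePreserving hassoc
  -- The exceptional `(w, x)` do not depend on `ξ`, because the transform is an honest integral at
  -- every `ξ`.
  have hrel : ∀ᵐ x : ℝ, ∀ᵐ w ∂circleHaar, ∀ ξ : ℝ,
      ∑ j ∈ s, (c j * (𝐞 (-(p j * ξ)) : ℂ)) * partialFourier G ((a j * w, x), ξ) = 0 := by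
    have h1 : ∀ᵐ q ∂(circleHaar.prod (volume : Measure ℝ)), ∀ ξ : ℝ,
        ∑ j ∈ s, (c j * (𝐞 (-(p j * ξ)) : ℂ)) * partialFourier G ((a j * q.1, q.2), ξ) = 0 := by
      filter_upwards [Measure.ae_ae_of_ae_prod h] with q hq ξ
      simp_rw [mul_assoc, ← partialFourier_comp_sub, ← integral_const_mul]
      rw [← integral_finsetSum s
        fun j _ => (hS.integrable_comp_sub (a j * q.1, q.2) (p j) ξ).const_mul (c j)]
      refine integral_eq_zero_of_ae ?_
      filter_upwards [hq] with y hy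
      have : ∑ j ∈ s, c j * (𝐞 (-(y * ξ)) • G ((a j * q.1, q.2), y - p j)) =
          (𝐞 (-(y * ξ)) : ℂ) * ∑ j ∈ s, c j * G ((a j * q.1, q.2), y - p j) := by
        rw [Finset.mul_sum]
        refine Finset.sum_congr rfl fun j _ => ?_
        rw [Circle.smul_def, smul_eq_mul]; ring
      rw [this, hy, mul_zero, Pi.zero_apply]
    have h2 := (Measure.measurePreserving_swap (μ := (volume : Measure ℝ))
      (ν := circleHaar)).quasiMeasurePreserving.ae h1
    exact Measure.ae_ae_of_ae_prod h2
  -- There are countably many `n`. The factor `a j ^ n` is absorbed into the coefficient, which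
  -- stays nonzero, so distinctness of the `p j` suffices.
  have hsymbol : ∀ᵐ ξ : ℝ, ∀ n : ℤ,
      ∑ j ∈ s, (c j * (𝐞 (-(p j * ξ)) : ℂ)) * ((a j ^ n : Circle) : ℂ) ≠ 0 := by
    rw [ae_all_iff]
    intro n
    filter_upwards [ae_sum_mul_fourierChar_ne_zero hs (b := fun j => c j * ((a j ^ n : Circle) : ℂ))
      (fun j hj => mul_ne_zero (hc j hj) (Circle.coe_ne_zero _)) hp] with ξ hξ
    convert hξ using 2
    ring
  have h0 : (fun r : Circle × ℝ × ℝ => partialFourier G ((r.1, r.2.1), r.2.2))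
      =ᵐ[circleHaar.prod (volume.prod volume)] 0 := by
    refine ae_prod_eq_zero_of_ae_ae_eq_zero hφ'.1 ?_
    filter_upwards [hφ'.ae_memLp_two_slice, Measure.quasiMeasurePreserving_fst.ae hrel,
      Measure.quasiMeasurePreserving_snd.ae hsymbol] with r hr1 hr2 hr3
    refine ae_eq_zero_of_sum_mul_comp_mul_eq_zero s (fun j => c j * (𝐞 (-(p j * r.2)) : ℂ)) a
      hr1 hr3 ?_
    filter_upwards [hr2] with w hw
    exact hw r.2
  exact (measurePreserving_prodAssoc circleHaar volume volume).quasiMeasurePreserving.ae h0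

/-! ### Propagation of vanishing on the Heisenberg group -/

namespace Heisenberg

/-- The order `((z, x), y)` puts the Fourier variable `y` last and makes `x` a parameter beside `z`.
-/
theorem measurePreserving_mk :
    MeasurePreserving (fun q : (Circle × ℝ) × ℝ => mk q.1.1 q.2 q.1.2)
      ((circleHaar.prod volume).prod volume) haar :=
  ((MeasurePreserving.id circleHaar).prod
    (Measure.measurePreserving_swap (μ := (volume : Measure ℝ)) (ν := (volume : Measure ℝ)))).comp
    (measurePreserving_prodAssoc circleHaar volume volume)

theorem measurePreserving_coordinates :
    MeasurePreserving (fun h : Heisenberg => ((h.z, h.x), h.y)) haar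
      ((circleHaar.prod volume).prod volume) :=
  ((measurePreserving_prodAssoc circleHaar volume volume).symm _).comp
    ((MeasurePreserving.id circleHaar).prod
      (Measure.measurePreserving_swap (μ := (volume : Measure ℝ)) (ν := (volume : Measure ℝ))))

/-- Elements with the same `y`- and `x`-coordinates lie in the same coset of the center. -/
theorem coset_eq_of_coordinates_eq {g h : Heisenberg} (hy : g.y = h.y) (hx : g.x = h.x) :
    (g : Heisenberg ⧸ Subgroup.center Heisenberg) = h := by
  rw [QuotientGroup.eq, Subgroup.mem_center_iff]
  intro k
  have hy0 : (g⁻¹ * h).y = 0 := by simp [hy]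
  have hx0 : (g⁻¹ * h).x = 0 := by simp [hx]
  generalize g⁻¹ * h = m at hy0 hx0
  ext1
  · rw [mul_z, mul_z, hy0, hx0, mul_zero, zero_mul, mul_comm k.z]
  · rw [mul_y, mul_y, add_comm]
  · rw [mul_x, mul_x, add_comm]

theorem IsSchwartzInYX.exists_slice {f : Heisenberg → ℂ} (hf : IsSchwartzInYX f) (a : Circle)
    (c : ℝ) : ∃ g : 𝓢(ℝ, ℂ), ∀ b, f (mk a b c) = g b := by
  obtain ⟨g, hg⟩ := hf a
  have htemp : (fun b : ℝ => (b, c)).HasTemperateGrowth := by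
    convert (ContinuousLinearMap.inl ℝ ℝ ℝ).hasTemperateGrowth.add
      (Function.HasTemperateGrowth.const ((0, c) : ℝ × ℝ)) using 1
    ext b <;> simp
  have hanti : AntilipschitzWith 1 (fun b : ℝ => (b, c)) :=
    AntilipschitzWith.of_le_mul_dist fun b b' => by simp [Prod.dist_eq]
  exact ⟨SchwartzMap.compCLMOfAntilipschitz ℂ htemp hanti g, fun b => hg b c⟩

/-- A linear relation between left translates of `f` propagates the vanishing of `f` on a
half-space by a fixed amount. -/
theorem exists_pos_vanishing_extends {ι : Type*} {s : Finset ι} (hs : s.Nonempty) {c : ι → ℂ}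
    (hc : ∀ j ∈ s, c j ≠ 0) {h : ι → Heisenberg}
    (hinj : Set.InjOn (fun j => ((h j).y, (h j).x)) s) {σ : ℝ} (hσ : σ ≠ 0)
    {f : Heisenberg → ℂ} (hf : MemLp f 2 haar) (hS : IsSchwartzInYX f)
    (hrel : ∀ᵐ g ∂haar, ∑ j ∈ s, c j * f ((h j)⁻¹ * g) = 0) :
    ∃ δ > 0, ∀ t : ℝ, (∀ᵐ g ∂haar, σ * g.x < t → f g = 0) →
      ∀ᵐ g ∂haar, σ * g.x < t + δ → f g = 0 := by
  classical
  obtain ⟨k, hk, hmin⟩ := s.exists_min_image (fun j => σ * (h j).x) hs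
  set s₀ := s.filter fun j => (h j).x = (h k).x with hs₀
  -- The gap depends only on the `h j`, not on `t`; this is what permits iteration.
  obtain ⟨δ, hδ, hgap⟩ : ∃ δ > 0, ∀ j ∈ s, (h j).x ≠ (h k).x →
      σ * (h k).x + δ ≤ σ * (h j).x := by
    have hfin : ∀ r : Finset ι, r ⊆ s → ∃ δ > 0, ∀ j ∈ r, (h j).x ≠ (h k).x →
        σ * (h k).x + δ ≤ σ * (h j).x := by
      intro r
      induction r using Finset.induction_on with
      | empty => exact fun _ => ⟨1, one_pos, by simp⟩
      | insert i r _ ih =>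
        intro hr
        obtain ⟨δ, hδ, hr'⟩ := ih fun j hj => hr (Finset.mem_insert_of_mem hj)
        by_cases hi : (h i).x = (h k).x
        · refine ⟨δ, hδ, fun j hj hne => ?_⟩
          rcases Finset.mem_insert.mp hj with rfl | hj
          · exact absurd hi hne
          · exact hr' j hj hne
        · have hlt : σ * (h k).x < σ * (h i).x :=
            lt_of_le_of_ne (hmin i (hr (Finset.mem_insert_self _ _)))
              fun he => hi (mul_left_cancel₀ hσ he).symm
          refine ⟨min δ (σ * (h i).x - σ * (h k).x), lt_min hδ (sub_pos.mpr hlt),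
            fun j hj hne => ?_⟩
          rcases Finset.mem_insert.mp hj with rfl | hj
          · linarith [min_le_right δ (σ * (h j).x - σ * (h k).x)]
          · linarith [min_le_left δ (σ * (h i).x - σ * (h k).x), hr' j hj hne]
    exact hfin s subset_rfl
  refine ⟨δ, hδ, fun t ht => ?_⟩
  -- For each `j ∈ s₀`, `(h j)⁻¹ * κ` has `x`-coordinate zero, so it acts on `(z, y)` by a
  -- translation independent of the point.
  set κ : Heisenberg := mk 1 0 (h k).x with hκ
  -- The sharp cut-off in `x` is harmless: smoothness is only needed along `y`.
  set G : (Circle × ℝ) × ℝ → ℂ :=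
    fun q => if σ * q.1.2 < t + δ then f (mk q.1.1 q.2 q.1.2) else 0 with hG
  have hGS : HasSchwartzSlices G := by
    intro q
    by_cases hq : σ * q.2 < t + δ
    · obtain ⟨g, hg⟩ := hS.exists_slice q.1 q.2
      exact ⟨g, fun y => by simp only [hG, if_pos hq, hg]⟩
    · exact ⟨0, fun y => by simp only [hG, if_neg hq]; rfl⟩
  have hGL : MemLp G 2 ((circleHaar.prod volume).prod volume) := by
    have hset : MeasurableSet {q : (Circle × ℝ) × ℝ | σ * q.1.2 < t + δ} :=
      measurableSet_lt (by fun_prop) (by fun_prop)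
    refine ((hf.comp_measurePreserving measurePreserving_mk).indicator hset).ae_eq ?_
    exact Filter.Eventually.of_forall fun q => by
      simp only [Set.indicator_apply, Set.mem_ofPred_eq, hG]; rfl
  have hterm : ∀ j, ∀ᵐ g ∂haar, σ * ((h j)⁻¹ * (κ * g)).x < t → f ((h j)⁻¹ * (κ * g)) = 0 :=
    fun j => (measurePreserving_mul_left κ).quasiMeasurePreserving.ae
      ((measurePreserving_mul_left (h j)⁻¹).quasiMeasurePreserving.ae ht)
  have hrelG : ∀ᵐ g ∂haar, ∑ j ∈ s₀, c j *
      G ((((h j)⁻¹ * κ).z * g.z, g.x), g.y - (h j).y) = 0 := by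
    filter_upwards [(measurePreserving_mul_left κ).quasiMeasurePreserving.ae hrel,
      (Finset.eventually_all s).mpr fun j _ => hterm j] with g hg1 hg2
    by_cases hg : σ * g.x < t + δ
    · rw [← hg1, ← Finset.sum_subset (Finset.filter_subset (fun j => (h j).x = (h k).x) s)]
      · refine Finset.sum_congr rfl fun j hj => ?_
        have hjx : (h j).x = (h k).x := (Finset.mem_filter.mp hj).2
        simp only [hG, if_pos hg]
        congr 2
        rw [← mul_assoc]
        ext1
        · simp [hκ, hjx]
        · simp [hκ, sub_eq_add_neg, add_comm]
        · simp [hκ, hjx]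
      -- For the other terms the gap gives `σ x < t + δ - δ = t` at the translated point, where `f`
      -- already vanishes.
      · intro j hj hj'
        have hjx : (h j).x ≠ (h k).x := fun he => hj' (Finset.mem_filter.mpr ⟨hj, he⟩)
        rw [hg2 j hj, mul_zero]
        have := hgap j hj hjx
        simp only [mul_x, inv_x, hκ, mk_x]
        linarith
    · simp only [hG, if_neg hg, mul_zero, Finset.sum_const_zero]
  have hzero := ae_eq_zero_of_sum_mul_translate_eq_zero (s := s₀)
    ⟨k, Finset.mem_filter.mpr ⟨hk, rfl⟩⟩ (fun j hj => hc j (Finset.mem_filter.mp hj).1)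
    (fun j => ((h j)⁻¹ * κ).z) (p := fun j => (h j).y)
    (fun i hi j hj hij => hinj (Finset.mem_filter.mp hi).1 (Finset.mem_filter.mp hj).1
      (Prod.ext hij ((Finset.mem_filter.mp hi).2.trans (Finset.mem_filter.mp hj).2.symm)))
    hGL hGS (measurePreserving_mk.quasiMeasurePreserving.ae hrelG)
  filter_upwards [measurePreserving_coordinates.quasiMeasurePreserving.ae hzero] with g hg hlt
  simp only [hG, if_pos hlt] at hg
  exact hg

/-- A square-integrable function that satisfies a nontrivial linear relation between its left
translates and vanishes on a half-space is zero. -/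
theorem ae_eq_zero_of_sum_mul_translate_eq_zero_of_vanishing {ι : Type*} {s : Finset ι}
    (hs : s.Nonempty) {c : ι → ℂ} (hc : ∀ j ∈ s, c j ≠ 0) {h : ι → Heisenberg}
    (hinj : Set.InjOn (fun j => ((h j).y, (h j).x)) s) {σ : ℝ} (hσ : σ ≠ 0)
    {f : Heisenberg → ℂ} (hf : MemLp f 2 haar) (hS : IsSchwartzInYX f)
    (hrel : ∀ᵐ g ∂haar, ∑ j ∈ s, c j * f ((h j)⁻¹ * g) = 0) {t : ℝ}
    (ht : ∀ g : Heisenberg, σ * g.x < t → f g = 0) : f =ᵐ[haar] 0 := by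
  obtain ⟨δ, hδ, hext⟩ := exists_pos_vanishing_extends hs hc hinj hσ hf hS hrel
  have hall : ∀ n : ℕ, ∀ᵐ g ∂haar, σ * g.x < t + n * δ → f g = 0 := by
    intro n
    induction n with
    | zero => exact Filter.Eventually.of_forall fun g hg => ht g (by simpa using hg)
    | succ n ih =>
      filter_upwards [hext _ ih] with g hg hlt
      refine hg (hlt.trans_le (le_of_eq ?_))
      push_cast; ring
  filter_upwards [ae_all_iff.mpr hall] with g hg
  obtain ⟨n, hn⟩ := exists_nat_gt ((σ * g.x - t) / δ)
  refine hg n ?_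
  rw [div_lt_iff₀ hδ] at hn
  linarith

end Heisenberg

/-! ### From linear dependence to a pointwise relation -/

theorem proposition3p3 (F : Heisenberg.L2) (hF : F ≠ 0) (f : Heisenberg → ℂ)
    (hfF : F =ᵐ[Heisenberg.haar] f)
    (hSchwartz : Heisenberg.IsSchwartzInYX f)
    (hSupp : Heisenberg.IsSupportedOnHalfLineInX f) :
    Heisenberg.HTConjectureFor F := by
  classical
  intro S hS
  rw [linearIndependent_iff']
  intro T c hT
  by_contra! hne
  obtain ⟨i, hiT, hi⟩ := hne
  have hf : MemLp f 2 Heisenberg.haar := (Lp.memLp F).ae_eq hfF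
  -- Only nonzero coefficients are kept, so that the extremal terms really occur.
  set s := T.filter fun j => c j ≠ 0 with hs
  have hrel : ∀ᵐ g ∂Heisenberg.haar, ∑ j ∈ s, c j * f ((j : Heisenberg)⁻¹ * g) = 0 := by
    have hterm : ∀ j : S, Heisenberg.leftTranslate (j : Heisenberg) F
        =ᵐ[Heisenberg.haar] fun g => f ((j : Heisenberg)⁻¹ * g) := fun j =>
      (Lp.coeFn_compMeasurePreserving F
        (Heisenberg.measurePreserving_mul_left (j : Heisenberg)⁻¹)).trans
        ((Heisenberg.measurePreserving_mul_left
          (j : Heisenberg)⁻¹).quasiMeasurePreserving.ae_eq_comp hfF)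
    have hsum : ∀ r : Finset S,
        (∑ j ∈ r, c j • Heisenberg.leftTranslate (j : Heisenberg) F : Heisenberg.L2)
          =ᵐ[Heisenberg.haar] fun g => ∑ j ∈ r, c j * f ((j : Heisenberg)⁻¹ * g) := by
      intro r
      induction r using Finset.induction_on with
      | empty =>
        simp only [Finset.sum_empty]
        exact Lp.coeFn_zero ℂ 2 Heisenberg.haar
      | insert j r hj ih =>
        rw [Finset.sum_insert hj]
        filter_upwards [Lp.coeFn_add (c j • Heisenberg.leftTranslate (j : Heisenberg) F)
          (∑ j ∈ r, c j • Heisenberg.leftTranslate (j : Heisenberg) F),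
          Lp.coeFn_smul (c j) (Heisenberg.leftTranslate (j : Heisenberg) F), hterm j, ih]
          with g h1 h2 h3 h4
        rw [h1, Pi.add_apply, h2, Pi.smul_apply, h3, h4, Finset.sum_insert hj, smul_eq_mul]
    have h0 := hsum T
    rw [hT] at h0
    filter_upwards [h0, Lp.coeFn_zero ℂ 2 Heisenberg.haar] with g h1 h2
    rw [h2, Pi.zero_apply] at h1
    rw [h1, hs, Finset.sum_filter_of_ne]
    intro j _ hj
    exact left_ne_zero_of_mul hj
  have hinj : Set.InjOn (fun j : S => ((j : Heisenberg).y, (j : Heisenberg).x)) s :=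
    fun j _ k _ hjk => Subtype.ext (hS j.2 k.2 (Heisenberg.coset_eq_of_coordinates_eq
      (congrArg Prod.fst hjk) (congrArg Prod.snd hjk)))
  have hsne : s.Nonempty := ⟨i, Finset.mem_filter.mpr ⟨hiT, hi⟩⟩
  have hsc : ∀ j ∈ s, c j ≠ 0 := fun j hj => (Finset.mem_filter.mp hj).2
  refine hF ((Lp.eq_zero_iff_ae_eq_zero).mpr (hfF.trans ?_))
  -- The sign `σ` reflects the half-line `x ≤ b` to `-b ≤ -x`, so one argument serves both cases.
  obtain ⟨b, hb | hb⟩ := hSupp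
  · exact Heisenberg.ae_eq_zero_of_sum_mul_translate_eq_zero_of_vanishing hsne hsc hinj
      (σ := 1) one_ne_zero hf hSchwartz hrel (t := b) fun g hg => by
        by_contra hg0
        linarith [hb g hg0]
  · exact Heisenberg.ae_eq_zero_of_sum_mul_translate_eq_zero_of_vanishing hsne hsc hinj
      (σ := -1) (neg_ne_zero.mpr one_ne_zero) hf hSchwartz hrel (t := -b) fun g hg => by
        by_contra hg0
        linarith [hb g hg0]
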